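/- Fix an integer $d\ge 1$ and reals $D,B,P,\sigma>0$, and put $\mathtt{SNR}=P/\sigma^2$. For a nonempty convex set $\mathcal X\subset\mathbb R^d$ with $\sup_{x,y\in\mathcal X}\|x-y\|_2\le D$, let $\mathcal O(\mathcal X)$ be the set of pairs $(f,O)$ where $f:\mathcal X\to\mathbb R$ is convex and $O$ is an oracle which, when queried at $x\in\mathcal X$, returns with fresh independent randomness a random vector $\hat g(x)\in\mathbb R^d$ such that $\mathbb E[\hat g(x)]$ is a subgradient of $f$ at $x$ (relative to $\mathcal X$) and $\mathbb E\|\hat g(x)\|_2^2\le B^2$. An analog over-the-air protocol of length $\ell$, $1\le\ell\le d$, with $T$ queries consists of an algorithm $\pi$ and random matrices $\mathbf A_1=\mathbf A(U_1),\dots,\mathbf A_T=\mathbf A(U_T)\in\mathbb R^{\ell\times d}$, where the public randomness $U=(U_1,\dots,U_T)$ (with any joint law) is known to encoder and algorithm and is independent of the oracle's randomness and of the channel noise. The matrices obey the average power constraint $\mathbb E\|\mathbf A_t\hat g\|_2^2\le\ell P$ for each $t$ and each random vector $\hat g$ independent of $U$ with $\mathbb E\|\hat g\|_2^2\le B^2$.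 In round $t=1,\dots,T$ the algorithm chooses, as a function of $U$ and $Y_1,\dots,Y_{t-1}$, a query point $x_t\in\mathcal X$, the oracle returns $\hat g_t=\hat g(x_t)$, and the algorithm observes $$Y_t=\mathbf A_t\hat g_t+Z_t,\qquad Z_t\sim\mathcal N(0,\sigma^2\mathbf I_\ell),$$ the $Z_t$ being independent over $t$ and independent of $U$ and of the oracle's randomness. At the end it outputs a point $\hat x\in\mathcal X$ as a function of $U$ and $Y_1,\dots,Y_T$. The protocol uses $\ell T$ channel transmissions. Let $$\mathcal E^*_{analog}(N)=\sup_{\mathcal X}\ \inf_{\text{analog protocols on }\mathcal X,\ \ell T\le N}\ \sup_{(f,O)\in\mathcal O(\mathcal X)}\Big(\mathbb E f(\hat x)-\inf_{x\in\mathcal X}f(x)\Big).$$ There is a universal constant $c\in(0,1)$ (not depending on $d,D,B,P,\sigma,N$) such that for every integer $N\ge d\,(1+1/\mathtt{SNR})$, $$\mathcal E^*_{analog}(N)\ \ge\ \frac{cDB}{\sqrt N}\,\sqrt{d+\frac{d}{\mathtt{SNR}}}.$$ -/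

import Mathlib

open MeasureTheory ProbabilityTheory

noncomputable section

namespace OverTheAir

/-- The signal-to-noise ratio `P / σ²`. -/
def snr (P σ : ℝ) : ℝ := P / σ ^ 2

/-- `g` is a subgradient at `x` of the function `f` on the domain `X`. -/
def IsSubgradient {d : ℕ} (X : Set (EuclideanSpace ℝ (Fin d)))
    (f : EuclideanSpace ℝ (Fin d) → ℝ) (x g : EuclideanSpace ℝ (Fin d)) : Prop :=
  ∀ y ∈ X, f x + inner ℝ g (y - x) ≤ f y

/-- The family of admissible domains: nonempty convex sets of diameter at most `D`. -/
structure IsAdmissibleDomain {d : ℕ} (D : ℝ) (X : Set (EuclideanSpace ℝ (Fin d))) : Prop where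
  nonempty : X.Nonempty
  convex : Convex ℝ X
  diam_le : ∀ x ∈ X, ∀ y ∈ X, ‖x - y‖ ≤ D

/-- A pair `(f, O)` of a convex function on `X` and a first-order oracle. When queried at `x`,
the oracle answers `answer x ξ`, where `ξ` is drawn afresh from `noise` at every query. The answer
is an unbiased subgradient estimate with second moment at most `B²`. -/
structure FunctionOracle {d : ℕ} (X : Set (EuclideanSpace ℝ (Fin d))) (B : ℝ) where
  f : EuclideanSpace ℝ (Fin d) → ℝ
  convexOn : ConvexOn ℝ X f
  Seed : Type
  [measurableSpaceSeed : MeasurableSpace Seed]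
  noise : Measure Seed
  [isProbabilityMeasure_noise : IsProbabilityMeasure noise]
  answer : X → Seed → EuclideanSpace ℝ (Fin d)
  measurable_answer : Measurable fun p : X × Seed => answer p.1 p.2
  unbiased : ∀ x : X, IsSubgradient X f x (∫ ξ, answer x ξ ∂noise)
  meanSquare : ∀ x : X, ∫⁻ ξ, ‖answer x ξ‖ₑ ^ 2 ∂noise ≤ ENNReal.ofReal (B ^ 2)

attribute [instance] FunctionOracle.measurableSpaceSeed FunctionOracle.isProbabilityMeasure_noise

/-- An over-the-air optimization protocol `(π, φ)` on the domain `X`: a code `φ = enc` of length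
`ℓ` with average power at most `P`, and an algorithm `π = (query, output)` that makes `T` oracle
queries.

Round `t` is encoded with the public randomness `u t`, and `law` is the joint law of
`u 0, …, u (T - 1)`. This law is arbitrary, so that both a single draw shared by all rounds and
fresh draws in each round are covered. The algorithm sees the public randomness and the past channel
outputs.

The power constraint is imposed for every estimate that an oracle may supply, that is, for every
random vector with second moment at most `B²` that is independent of the public randomness. -/
structure Protocol {d : ℕ} (X : Set (EuclideanSpace ℝ (Fin d))) (B P : ℝ) where
  ℓ : ℕ
  one_le_length : 1 ≤ ℓ
  T : ℕ
  U : Type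
  [measurableSpaceU : MeasurableSpace U]
  law : Measure (Fin T → U)
  [isProbabilityMeasure_law : IsProbabilityMeasure law]
  enc : EuclideanSpace ℝ (Fin d) → U → Fin ℓ → ℝ
  measurable_enc : Measurable fun p : EuclideanSpace ℝ (Fin d) × U => enc p.1 p.2
  power : ∀ (t : Fin T) (μ : Measure (EuclideanSpace ℝ (Fin d))), IsProbabilityMeasure μ →
    ∫⁻ g, ‖g‖ₑ ^ 2 ∂μ ≤ ENNReal.ofReal (B ^ 2) →
    ∫⁻ u, ∫⁻ g, ENNReal.ofReal (∑ i, enc g (u t) i ^ 2) ∂μ ∂law ≤ ENNReal.ofReal (ℓ * P)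
  query : (t : Fin T) → (Fin T → U) → (Fin t → Fin ℓ → ℝ) → X
  measurable_query : ∀ t : Fin T,
    Measurable fun p : (Fin T → U) × (Fin t → Fin ℓ → ℝ) => query t p.1 p.2
  output : (Fin T → U) → (Fin T → Fin ℓ → ℝ) → X
  measurable_output :
    Measurable fun p : (Fin T → U) × (Fin T → Fin ℓ → ℝ) => output p.1 p.2

attribute [instance] Protocol.measurableSpaceU Protocol.isProbabilityMeasure_law

variable {d : ℕ} {X : Set (EuclideanSpace ℝ (Fin d))} {B P : ℝ}

/-- The code is analog: its length is at most `d`, and the encoder multiplies the subgradient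
estimate by an `ℓ × d` matrix, which may depend on the public randomness. -/
def Protocol.IsAnalog (π : Protocol X B P) : Prop :=
  π.ℓ ≤ d ∧ ∃ A : π.U → Matrix (Fin π.ℓ) (Fin d) ℝ,
    ∀ (g : EuclideanSpace ℝ (Fin d)) (u : π.U), π.enc g u = (A u).mulVec (fun j => g j)

/-- The first `t` channel outputs `Y_0, …, Y_{t-1}`, as a function of the public randomness `u`,
the oracle seeds `ξ` and the channel noise `z`. -/
def Protocol.channelOutputs (π : Protocol X B P) (O : FunctionOracle X B)
    (u : Fin π.T → π.U) (ξ : Fin π.T → O.Seed) (z : Fin π.T → Fin π.ℓ → ℝ) :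
    (t : ℕ) → t ≤ π.T → Fin t → Fin π.ℓ → ℝ
  | 0, _ => Fin.elim0
  | t + 1, h =>
    let past := Protocol.channelOutputs π O u ξ z t (Nat.le_of_succ_le h)
    let x := π.query ⟨t, h⟩ u past
    let g := O.answer x (ξ ⟨t, h⟩)
    Fin.snoc past (π.enc g (u ⟨t, h⟩) + z ⟨t, h⟩)

/-- The point that the protocol returns after `T` rounds. -/
def Protocol.result (π : Protocol X B P) (O : FunctionOracle X B)
    (u : Fin π.T → π.U) (ξ : Fin π.T → O.Seed) (z : Fin π.T → Fin π.ℓ → ℝ) : X :=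
  π.output u (π.channelOutputs O u ξ z π.T le_rfl)

/-- The joint law of the public randomness, the oracle seeds and the channel noise: the three are
independent, the seeds are i.i.d., and the channel noise is i.i.d. `N(0, σ²)`. -/
def Protocol.jointLaw (π : Protocol X B P) (O : FunctionOracle X B) (σ : ℝ) :
    Measure ((Fin π.T → π.U) × (Fin π.T → O.Seed) × (Fin π.T → Fin π.ℓ → ℝ)) :=
  π.law.prod ((Measure.pi fun _ => O.noise).prod
    (Measure.pi fun _ => Measure.pi fun _ => gaussianReal 0 ⟨σ ^ 2, sq_nonneg σ⟩))

/-- The convergence error `E[f(x_T)] - inf_X f`. -/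
def Protocol.error (π : Protocol X B P) (O : FunctionOracle X B) (σ : ℝ) : ℝ :=
  ∫ ω, O.f (π.result O ω.1 ω.2.1 ω.2.2) ∂(π.jointLaw O σ) - ⨅ x : X, O.f x

/-- The min-max error of analog protocols with at most `N` channel uses: the supremum over domains
of the infimum over analog protocols of the supremum over functions and oracles. -/
def analogMinimaxError (d N : ℕ) (D B P σ : ℝ) : EReal :=
  ⨆ (X : Set (EuclideanSpace ℝ (Fin d))) (_ : IsAdmissibleDomain D X),
    ⨅ (π : Protocol X B P) (_ : π.IsAnalog ∧ π.ℓ * π.T ≤ N),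
      ⨆ O : FunctionOracle X B, (π.error O σ : EReal)

end OverTheAir

end

/-! The hard instances are the linear functions `⟨θ, x⟩` on the cube of diameter `D`, with `θ ∈ {-δ,
δ}^d` and an oracle that answers `θ + s ξ`, `ξ` standard Gaussian. The answer does not depend on the
query, so adaptivity gains nothing: optimizing amounts to guessing the signs of `θ` from the outputs
`A_t (θ + s ξ_t) + Z_t`.

This is Assouad's method. Flipping one sign moves the mean by `2δ e_j`. If that move is imitated by
translating the Gaussian seeds and noise, the likelihood ratio of the translation has second moment
`exp K`, where `K` is the squared size of the translation relative to the variances. Expectations of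
outputs in `[-r, r]` then change by at most `r (1/4 + 2K)` (`abs_integral_comp_add_sub_le`). If the
values of `K`, summed over the coordinates, average at most `d/8`, some sign vector forces an error
of at least three quarters of `δ r d` (`exists_le_error`).

There are two ways to pay for the move. The channel noise absorbs it at a cost bounded by the power
constraint, `4δ²NPd / (B²σ²)` in total over coordinates and rounds (`exists_le_error_of_power`, for
low SNR). Or the oracle's randomness absorbs it: an `ℓ × d` matrix sees only the projection onto the
complement of its kernel, a projection of trace at most `ℓ`, so the total cost is `4δ²N / s²`
(`exists_le_error_of_dimension`, for high SNR). Taking `δ` of order `B / √(N min(1, SNR))` serves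
both. -/

noncomputable section

namespace OverTheAir

/-! ### Densities of translated measures. -/

/-- The translate of `μ` by `m` has the density `L` with respect to `μ`, and the second moment of
`L` under `μ` is `exp K`. -/
structure HasShiftDensity {E : Type*} [MeasurableSpace E] [Add E] (μ : Measure E) (m : E)
    (L : E → ℝ) (K : ℝ) : Prop where
  measurable : Measurable L
  nonneg : ∀ x, 0 ≤ L x
  map_eq : μ.map (fun x => x + m) = μ.withDensity fun x => ENNReal.ofReal (L x)
  integrable_sq : Integrable (fun x => L x ^ 2) μ
  integral_sq : ∫ x, L x ^ 2 ∂μ = Real.exp K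
  exponent_nonneg : 0 ≤ K

namespace HasShiftDensity

variable {E : Type*} [MeasurableSpace E] [Add E] {μ : Measure E} {m : E} {L : E → ℝ} {K : ℝ}

theorem integrable [IsFiniteMeasure μ] (h : HasShiftDensity μ m L K) : Integrable L μ := by
  refine ((integrable_const (1 : ℝ)).add h.integrable_sq).mono'
    h.measurable.aestronglyMeasurable (ae_of_all _ fun x => ?_)
  rw [Real.norm_of_nonneg (h.nonneg x)]
  simp only [Pi.add_apply]
  nlinarith [sq_nonneg (L x - 1), h.nonneg x]

theorem integral_comp_add [MeasurableAdd₂ E] (h : HasShiftDensity μ m L K) {g : E → ℝ}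
    (hg : Measurable g) : ∫ x, g (x + m) ∂μ = ∫ x, L x * g x ∂μ := by
  have hm : Measurable fun x : E => x + m := measurable_id.add_const m
  rw [← integral_map hm.aemeasurable hg.aestronglyMeasurable, h.map_eq, integral_withDensity_eq_integral_toReal_smul
    h.measurable.ennreal_ofReal (ae_of_all _ fun _ => ENNReal.ofReal_lt_top)]
  simp [ENNReal.toReal_ofReal (h.nonneg _)]

theorem integral_eq_one [MeasurableAdd₂ E] [IsProbabilityMeasure μ] (h : HasShiftDensity μ m L K) :
    ∫ x, L x ∂μ = 1 := by
  simpa using (h.integral_comp_add (g := fun _ => (1 : ℝ)) measurable_const).symm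

/-- Expectations of bounded functions change little under a translation with small exponent. -/
theorem abs_integral_comp_add_sub_le [MeasurableAdd₂ E] [IsProbabilityMeasure μ]
    (h : HasShiftDensity μ m L K) {g : E → ℝ} (hg : Measurable g) {r : ℝ}
    (hr : ∀ x, |g x| ≤ r) :
    |∫ x, g (x + m) ∂μ - ∫ x, g x ∂μ| ≤ r * (1 / 4 + 2 * K) := by
  have hgi : Integrable g μ :=
    Integrable.of_bound hg.aestronglyMeasurable r (ae_of_all _ hr)
  have hr0 : 0 ≤ r := by
    obtain ⟨x⟩ := μ.nonempty_of_neZero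
    exact (abs_nonneg _).trans (hr x)
  -- For `K ≥ 1` the trivial bound `2r` suffices; below 1, `exp K - 1 ≤ 2K`.
  rcases le_or_gt 1 K with hK | hK
  · have h1 : |∫ x, g (x + m) ∂μ| ≤ r := by
      simpa using norm_integral_le_of_norm_le_const (μ := μ) (C := r)
        (f := fun x => g (x + m)) (ae_of_all _ fun x => hr (x + m))
    have h2 : |∫ x, g x ∂μ| ≤ r := by
      simpa using norm_integral_le_of_norm_le_const (μ := μ) (C := r) (f := g) (ae_of_all _ hr)
    calc _ ≤ |∫ x, g (x + m) ∂μ| + |∫ x, g x ∂μ| := abs_sub _ _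
      _ ≤ r * (1 / 4 + 2 * K) := by nlinarith
  have hLg : Integrable (fun x => L x * g x) μ :=
    h.integrable.mul_bdd hg.aestronglyMeasurable (ae_of_all _ hr)
  have hsq : Integrable (fun x => (L x - 1) ^ 2) μ := by
    have : (fun x => (L x - 1) ^ 2) = fun x => L x ^ 2 - 2 * L x + 1 := by ext x; ring
    rw [this]
    exact (h.integrable_sq.sub (h.integrable.const_mul 2)).add (integrable_const _)
  have hsq' : ∫ x, (L x - 1) ^ 2 ∂μ = Real.exp K - 1 := by
    have : (fun x => (L x - 1) ^ 2) = fun x => L x ^ 2 - 2 * L x + 1 := by ext x; ring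
    have hd : Integrable (fun x => L x ^ 2 - 2 * L x) μ :=
      h.integrable_sq.sub (h.integrable.const_mul 2)
    rw [this, integral_add hd (integrable_const _),
      integral_sub h.integrable_sq (h.integrable.const_mul 2), integral_const_mul,
      h.integral_eq_one, h.integral_sq]
    simp
    ring
  rw [h.integral_comp_add hg, ← integral_sub hLg hgi]
  have hexp : Real.exp K - 1 ≤ 2 * K := by
    have := Real.abs_exp_sub_one_le (x := K) (by rw [abs_of_nonneg h.exponent_nonneg]; exact hK.le)
    rw [abs_of_nonneg h.exponent_nonneg] at this
    exact (le_abs_self _).trans this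
  calc |∫ x, (L x * g x - g x) ∂μ| ≤ ∫ x, r * (1 / 4 + (L x - 1) ^ 2) ∂μ := by
        refine norm_integral_le_of_norm_le (f := fun x => L x * g x - g x)
          (((integrable_const _).add hsq).const_mul r) (ae_of_all _ fun x => ?_)
        have e : L x * g x - g x = (L x - 1) * g x := by ring
        rw [Real.norm_eq_abs, e, abs_mul, mul_comm]
        -- Used in place of Cauchy-Schwarz, which would give `√K`: a bound linear in `K` can be
        -- summed over coordinates and averaged over the public randomness.
        have : |L x - 1| ≤ 1 / 4 + (L x - 1) ^ 2 := by
          rw [← sq_abs]; nlinarith [sq_nonneg (|L x - 1| - 1 / 2)]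
        exact mul_le_mul (hr x) this (abs_nonneg _) hr0
    _ = r * (1 / 4 + (Real.exp K - 1)) := by
        rw [integral_const_mul, integral_add (integrable_const _) hsq, hsq']; simp
    _ ≤ r * (1 / 4 + 2 * K) := by gcongr

/-- Shift densities tensorize. -/
theorem pi {ι : Type*} [Fintype ι] {F : ι → Type*} [∀ i, MeasurableSpace (F i)] [∀ i, Add (F i)]
    [∀ i, MeasurableAdd₂ (F i)] {μ : ∀ i, Measure (F i)} [∀ i, IsProbabilityMeasure (μ i)]
    {m : ∀ i, F i} {L : ∀ i, F i → ℝ} {K : ι → ℝ}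
    (h : ∀ i, HasShiftDensity (μ i) (m i) (L i) (K i)) :
    HasShiftDensity (Measure.pi μ) m (fun x => ∏ i, L i (x i)) (∑ i, K i) where
  measurable := Finset.measurable_prod _ fun i _ => (h i).measurable.comp (measurable_pi_apply i)
  nonneg x := Finset.prod_nonneg fun i _ => (h i).nonneg _
  map_eq := by
    have hm : ∀ i, Measurable fun x : F i => x + m i := fun i => measurable_id.add_const (m i)
    have : ∀ i, IsProbabilityMeasure ((μ i).map fun x => x + m i) :=
      fun i => Measure.isProbabilityMeasure_map (hm i).aemeasurable
    have e : (Measure.pi μ).map (fun x => x + m) =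
        Measure.pi fun i => (μ i).map fun x => x + m i :=
      Measure.pi_map_pi (f := fun i x => x + m i) fun i => (hm i).aemeasurable
    rw [e]
    -- It is enough to compare the measures on boxes, whose indicators factor like the density.
    refine Measure.pi_eq fun s hs => ?_
    have hi : ∀ i, Integrable ((s i).indicator (L i)) (μ i) :=
      fun i => (h i).integrable.indicator (hs i)
    have hn : ∀ i x, 0 ≤ (s i).indicator (L i) x :=
      fun i x => Set.indicator_nonneg (fun x _ => (h i).nonneg x) x
    have hind : ∀ i, ((μ i).map fun x => x + m i) (s i) =
        ENNReal.ofReal (∫ x, (s i).indicator (L i) x ∂μ i) := by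
      intro i
      rw [(h i).map_eq, withDensity_apply _ (hs i), integral_indicator (hs i),
        ofReal_integral_eq_lintegral_ofReal (h i).integrable.integrableOn
          (ae_of_all _ (h i).nonneg)]
    simp_rw [hind]
    rw [← ENNReal.ofReal_prod_of_nonneg fun i _ => integral_nonneg (hn i),
      ← integral_fintype_prod_eq_prod (𝕜 := ℝ),
      ofReal_integral_eq_lintegral_ofReal (Integrable.fintype_prod_dep hi)
        (ae_of_all _ fun x => Finset.prod_nonneg fun i _ => hn i (x i)),
      withDensity_apply _ (MeasurableSet.univ_pi hs), ← lintegral_indicator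
        (MeasurableSet.univ_pi hs)]
    refine lintegral_congr fun x => ?_
    by_cases hx : x ∈ Set.univ.pi s
    · rw [Set.indicator_of_mem hx]
      congr 1
      exact Finset.prod_congr rfl fun i _ => (Set.indicator_of_mem (hx i (Set.mem_univ i)) _).symm
    · rw [Set.indicator_of_notMem hx]
      simp only [Set.mem_univ_pi, not_forall] at hx
      obtain ⟨i, hi⟩ := hx
      rw [Finset.prod_eq_zero (Finset.mem_univ i) (Set.indicator_of_notMem hi _)]
      simp
  integrable_sq := by
    simp_rw [← Finset.prod_pow]
    exact Integrable.fintype_prod_dep fun i => (h i).integrable_sq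
  integral_sq := by
    simp_rw [← Finset.prod_pow]
    rw [integral_fintype_prod_eq_prod (𝕜 := ℝ) (fun i x => L i x ^ 2), Real.exp_sum]
    exact Finset.prod_congr rfl fun i _ => (h i).integral_sq
  exponent_nonneg := Finset.sum_nonneg fun i _ => (h i).exponent_nonneg

end HasShiftDensity

/-- The density is the ratio of two Gaussian densities. Its square is an exponential tilt, so the
second moment is the moment generating function at `2m/v` times `exp (-m²/v)`. -/
theorem hasShiftDensity_gaussianReal {v : NNReal} (hv : v ≠ 0) (m : ℝ) :
    HasShiftDensity (gaussianReal 0 v) m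
      (fun x => Real.exp (m / v * x - m ^ 2 / (2 * v))) (m ^ 2 / v) := by
  have hv' : (v : ℝ) ≠ 0 := by exact_mod_cast hv
  have hsq : (fun x => Real.exp (m / v * x - m ^ 2 / (2 * v)) ^ 2) =
      fun x => Real.exp (- m ^ 2 / v) * Real.exp (2 * m / v * x) := by
    ext x
    rw [← Real.exp_nat_mul, ← Real.exp_add]
    congr 1
    field_simp
    push_cast
    ring
  refine ⟨by fun_prop, fun x => (Real.exp_pos _).le, ?_, ?_, ?_, by positivity⟩
  · rw [gaussianReal_map_add_const, gaussianReal_of_var_ne_zero _ hv,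
      gaussianReal_of_var_ne_zero _ hv, ← withDensity_mul _ (measurable_gaussianPDF _ _)
        (by fun_prop)]
    congr 1
    ext x
    simp only [Pi.mul_apply, gaussianPDF, gaussianPDFReal]
    rw [← ENNReal.ofReal_mul (by positivity), mul_assoc (√_)⁻¹, ← Real.exp_add]
    congr 3
    field_simp
    ring
  · rw [hsq]
    exact (integrable_exp_mul_gaussianReal _).const_mul _
  · rw [hsq, integral_const_mul]
    have := congrFun (mgf_id_gaussianReal (μ := 0) (v := v)) (2 * m / v)
    simp only [mgf, id] at this
    rw [this, ← Real.exp_add]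
    congr 1
    field_simp
    ring

/-- The exponent of a shift of i.i.d. Gaussian vectors is the squared norm of the shift over the
variance. -/
theorem exists_hasShiftDensity_pi_gaussianReal {ι κ : Type*} [Fintype ι] [Fintype κ] {v : NNReal}
    (hv : v ≠ 0) (m : ι → κ → ℝ) :
    ∃ L, HasShiftDensity (Measure.pi fun _ : ι => Measure.pi fun _ : κ => gaussianReal 0 v) m L
      (∑ i, ∑ k, m i k ^ 2 / v) :=
  ⟨_, HasShiftDensity.pi fun i => HasShiftDensity.pi fun k =>
    hasShiftDensity_gaussianReal hv (m i k)⟩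

theorem HasShiftDensity.prod {E F : Type*} [MeasurableSpace E] [Add E] [MeasurableAdd₂ E]
    [MeasurableSpace F] [Add F] [MeasurableAdd₂ F]
    {μ : Measure E} [IsProbabilityMeasure μ] {ν : Measure F} [IsProbabilityMeasure ν]
    {m : E} {n : F} {L : E → ℝ} {M : F → ℝ} {J K : ℝ}
    (hL : HasShiftDensity μ m L J) (hM : HasShiftDensity ν n M K) :
    HasShiftDensity (μ.prod ν) (m, n) (fun x => L x.1 * M x.2) (J + K) where
  measurable := (hL.measurable.comp measurable_fst).mul (hM.measurable.comp measurable_snd)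
  nonneg x := mul_nonneg (hL.nonneg _) (hM.nonneg _)
  map_eq := by
    have e : (fun x : E × F => x + (m, n)) = Prod.map (fun x => x + m) (fun x => x + n) := rfl
    have hm : Measurable fun x : E => x + m := measurable_id.add_const m
    have hn : Measurable fun x : F => x + n := measurable_id.add_const n
    rw [e, ← Measure.map_prod_map _ _ hm hn, hL.map_eq, hM.map_eq, prod_withDensity hL.measurable.ennreal_ofReal
      hM.measurable.ennreal_ofReal]
    simp_rw [← ENNReal.ofReal_mul (hL.nonneg _)]
  integrable_sq := by
    simp_rw [mul_pow]
    exact hL.integrable_sq.mul_prod hM.integrable_sq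
  integral_sq := by
    simp_rw [mul_pow]
    rw [integral_prod_mul (fun x => L x ^ 2) (fun x => M x ^ 2), hL.integral_sq, hM.integral_sq,
      Real.exp_add]
  exponent_nonneg := add_nonneg hL.exponent_nonneg hM.exponent_nonneg

/-! ### Directions visible through a matrix with `ℓ` rows. -/

/-- The standard basis vectors can be compressed, without changing their images under a linear map
to `ℝ^ℓ`, so that the sum of their squared norms is at most `ℓ`. -/
theorem exists_preimages_sum_sq_le {d ℓ : ℕ} (A : EuclideanSpace ℝ (Fin d) →ₗ[ℝ] (Fin ℓ → ℝ)) :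
    ∃ p : Fin d → EuclideanSpace ℝ (Fin d),
      (∀ j, A (p j) = A (EuclideanSpace.single j 1)) ∧ ∑ j, ‖p j‖ ^ 2 ≤ ℓ := by
  let S : Submodule ℝ (EuclideanSpace ℝ (Fin d)) := (LinearMap.ker A)ᗮ
  let e : OrthonormalBasis (Fin d) ℝ (EuclideanSpace ℝ (Fin d)) := EuclideanSpace.basisFun _ _
  -- Projecting `e j` onto `S` removes only a kernel component. The squared norms add up to the
  -- trace of the projection, which is `dim S = rank A ≤ ℓ`.
  refine ⟨fun j => S.starProjection (e j), fun j => ?_, ?_⟩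
  · have h := Submodule.sub_starProjection_mem_orthogonal (K := S) (e j)
    rw [Submodule.orthogonal_orthogonal, LinearMap.mem_ker, map_sub, sub_eq_zero] at h
    rw [← h]
    simp [e]
  · let b := stdOrthonormalBasis ℝ S
    have h1 : ∀ j, ‖S.starProjection (e j)‖ ^ 2 =
        ∑ k, ‖inner ℝ ((b k : S) : EuclideanSpace ℝ (Fin d)) (e j)‖ ^ 2 := by
      intro j
      rw [Submodule.starProjection_apply, ← Submodule.coe_norm, ← b.sum_sq_norm_inner_right]
      simp_rw [Submodule.inner_orthogonalProjectionOnto_eq_of_mem_left]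
    simp_rw [h1]
    rw [Finset.sum_comm]
    have h2 : ∀ k, ∑ j, ‖inner ℝ ((b k : S) : EuclideanSpace ℝ (Fin d)) (e j)‖ ^ 2 = 1 := by
      intro k
      rw [e.sum_sq_norm_inner_left, ← Submodule.coe_norm, b.orthonormal.1 k, one_pow]
    simp_rw [h2]
    have h3 := (LinearMap.ker A).finrank_add_finrank_orthogonal
    have h4 := A.finrank_range_add_finrank_ker
    have h5 : Module.finrank ℝ (LinearMap.range A) ≤ ℓ := by
      simpa using Submodule.finrank_le (LinearMap.range A)
    have h6 : Module.finrank ℝ S ≤ ℓ := by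
      change Module.finrank ℝ ((LinearMap.ker A)ᗮ : Submodule _ _) ≤ ℓ
      omega
    simpa using (by exact_mod_cast h6 : (Module.finrank ℝ S : ℝ) ≤ ℓ)

/-! ### Channel outputs under Gaussian seeds and noise. -/

/-- The channel outputs in `T` rounds in which the Gaussian estimate `θ + s ξ_t` is multiplied by
`A t` and sent over the additive channel. -/
def linearOutputs {d ℓ T : ℕ} (A : Fin T → EuclideanSpace ℝ (Fin d) →ₗ[ℝ] (Fin ℓ → ℝ)) (s : ℝ)
    (θ : EuclideanSpace ℝ (Fin d)) (ω : (Fin T → Fin d → ℝ) × (Fin T → Fin ℓ → ℝ)) :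
    Fin T → Fin ℓ → ℝ :=
  fun t => A t (θ + s • WithLp.toLp 2 (ω.1 t)) + ω.2 t

theorem measurable_linearOutputs {d ℓ T : ℕ}
    (A : Fin T → EuclideanSpace ℝ (Fin d) →ₗ[ℝ] (Fin ℓ → ℝ)) (s : ℝ)
    (θ : EuclideanSpace ℝ (Fin d)) : Measurable (linearOutputs A s θ) := by
  refine measurable_pi_lambda _ fun t => ?_
  have hA : Measurable (A t) := (A t).continuous_of_finiteDimensional.measurable
  unfold linearOutputs
  refine (hA.comp ?_).add ((measurable_pi_apply t).comp measurable_snd)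
  have h : Measurable fun ω : (Fin T → Fin d → ℝ) × (Fin T → Fin ℓ → ℝ) =>
      (WithLp.toLp 2 (ω.1 t) : EuclideanSpace ℝ (Fin d)) :=
    (WithLp.measurable_toLp 2 _).comp ((measurable_pi_apply t).comp measurable_fst)
  exact (h.const_smul s).const_add θ

/-- The law of the oracle seeds and of the channel noise, when both are Gaussian. -/
def noiseLaw (d ℓ T : ℕ) (v : NNReal) :
    Measure ((Fin T → Fin d → ℝ) × (Fin T → Fin ℓ → ℝ)) :=
  (Measure.pi fun _ => Measure.pi fun _ => gaussianReal 0 1).prod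
    (Measure.pi fun _ => Measure.pi fun _ => gaussianReal 0 v)

instance (d ℓ T : ℕ) (v : NNReal) : IsProbabilityMeasure (noiseLaw d ℓ T v) := by
  unfold noiseLaw; infer_instance

/-- Expectations of bounded functions of the channel outputs at two parameters are close when the
difference of the parameters can be absorbed by shifts `p` of the seeds and `q` of the noise. -/
theorem abs_integral_linearOutputs_sub_le {d ℓ T : ℕ}
    (A : Fin T → EuclideanSpace ℝ (Fin d) →ₗ[ℝ] (Fin ℓ → ℝ)) (s : ℝ) {v : NNReal} (hv : v ≠ 0)
    {θ θ' : EuclideanSpace ℝ (Fin d)} {p : Fin T → EuclideanSpace ℝ (Fin d)}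
    {q : Fin T → Fin ℓ → ℝ} (hpq : ∀ t, A t (θ' - θ) = A t (s • p t) + q t)
    {g : (Fin T → Fin ℓ → ℝ) → ℝ} (hg : Measurable g) {r : ℝ} (hr : ∀ y, |g y| ≤ r) :
    |∫ ω, g (linearOutputs A s θ' ω) ∂noiseLaw d ℓ T v -
      ∫ ω, g (linearOutputs A s θ ω) ∂noiseLaw d ℓ T v| ≤
      r * (1 / 4 + 2 * (∑ t, ‖p t‖ ^ 2 + ∑ t, ∑ i, q t i ^ 2 / v)) := by
  obtain ⟨L, hL⟩ := exists_hasShiftDensity_pi_gaussianReal (ι := Fin T) (κ := Fin d)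
    one_ne_zero fun t => (p t).ofLp
  obtain ⟨M, hM⟩ := exists_hasShiftDensity_pi_gaussianReal (ι := Fin T) (κ := Fin ℓ) hv q
  have h := (hL.prod hM).abs_integral_comp_add_sub_le
    (hg.comp (measurable_linearOutputs A s θ)) (fun x => hr _)
  have e : ∀ ω : (Fin T → Fin d → ℝ) × (Fin T → Fin ℓ → ℝ),
      linearOutputs A s θ (ω + (fun t => (p t).ofLp, q)) = linearOutputs A s θ' ω := by
    intro ω
    funext t
    have h1 : θ + s • (WithLp.toLp 2 (ω.1 t + (p t).ofLp) : EuclideanSpace ℝ (Fin d)) =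
        (θ + s • WithLp.toLp 2 (ω.1 t)) + s • p t := by
      rw [WithLp.toLp_add, WithLp.toLp_ofLp, smul_add, add_assoc]
    have h2 : A t θ' = A t θ + (A t (s • p t) + q t) := by rw [← hpq, map_sub]; abel
    change A t (θ + s • WithLp.toLp 2 (ω.1 t + (p t).ofLp)) + (ω.2 t + q t) =
      A t (θ' + s • WithLp.toLp 2 (ω.1 t)) + ω.2 t
    rw [h1, map_add, map_add, map_add, h2]
    abel
  simp only [Function.comp_def, e] at h
  have e2 : ∀ t, ‖p t‖ ^ 2 = ∑ k, (p t).ofLp k ^ 2 / ((1 : NNReal) : ℝ) := by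
    intro t
    simp [EuclideanSpace.norm_sq_eq]
  simp_rw [e2]
  exact h

/-! ### Averaging over sign vectors. -/

/-- The sign attached to a bit. -/
def sign (b : Bool) : ℝ := if b then 1 else -1

@[simp] theorem abs_sign (b : Bool) : |sign b| = 1 := by cases b <;> simp [sign]

@[simp] theorem sign_not (b : Bool) : sign (!b) = -sign b := by cases b <;> simp [sign]

@[simp] theorem sign_mul_self (b : Bool) : sign b * sign b = 1 := by cases b <;> simp [sign]

/-- Flip the `j`-th bit. -/
def flipBit {d : ℕ} (j : Fin d) (α : Fin d → Bool) : Fin d → Bool := Function.update α j (!α j)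

theorem flipBit_involutive {d : ℕ} (j : Fin d) : Function.Involutive (flipBit j) := by
  intro α
  simp [flipBit]

/-- If flipping the `j`-th bit changes `J j` by at most `b j`, then the correlation of the bits with
`J` is small on average. -/
theorem sum_sign_mul_ge {d : ℕ} (J : Fin d → (Fin d → Bool) → ℝ) (b : Fin d → ℝ)
    (h : ∀ j α, |J j α - J j (flipBit j α)| ≤ b j) :
    -(2 ^ d / 2 * ∑ j, b j) ≤ ∑ α, ∑ j, sign (α j) * J j α := by
  rw [Finset.sum_comm, Finset.mul_sum, ← Finset.sum_neg_distrib]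
  refine Finset.sum_le_sum fun j _ => ?_
  -- Reindexing by the flip reverses the sign, so twice the sum is a sum of differences across
  -- flipped bits.
  have e : ∑ α, sign (α j) * J j α = -∑ α, sign (α j) * J j (flipBit j α) := by
    rw [← Equiv.sum_comp (flipBit_involutive j).toPerm, ← Finset.sum_neg_distrib]
    refine Finset.sum_congr rfl fun α _ => ?_
    have : sign (flipBit j α j) = -sign (α j) := by simp [flipBit]
    simp [this]
  have e2 : 2 * ∑ α, sign (α j) * J j α =
      ∑ α, sign (α j) * (J j α - J j (flipBit j α)) := by
    simp_rw [mul_sub]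
    rw [Finset.sum_sub_distrib]
    linarith
  have hb : -(2 ^ d * b j) ≤ ∑ α, sign (α j) * (J j α - J j (flipBit j α)) := by
    have : ∑ _α : Fin d → Bool, -b j = -(2 ^ d * b j) := by simp
    rw [← this]
    refine Finset.sum_le_sum fun α _ => neg_le_of_abs_le ?_
    rw [abs_mul, abs_sign, one_mul]
    exact h j α
  linarith

/-! ### The Gaussian oracle. -/

theorem integral_gaussianEstimate {d : ℕ} (θ : EuclideanSpace ℝ (Fin d)) (s : ℝ) :
    ∫ ξ, (θ + s • WithLp.toLp 2 ξ) ∂(Measure.pi fun _ : Fin d => gaussianReal 0 1) = θ := by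
  have hm : ∀ j, MeasurePreserving (Function.eval j)
      (Measure.pi fun _ : Fin d => gaussianReal 0 1) (gaussianReal 0 1) :=
    measurePreserving_eval fun _ : Fin d => gaussianReal 0 1
  have hid : Integrable (fun x : ℝ => x) (gaussianReal 0 1) :=
    (memLp_id_gaussianReal 1).integrable (by norm_num)
  have hi : ∀ j, Integrable (fun ξ : Fin d → ℝ => ξ j)
      (Measure.pi fun _ : Fin d => gaussianReal 0 1) :=
    fun j => (hm j).integrable_comp_of_integrable hid
  have h0 : ∀ j, ∫ ξ, ξ j ∂(Measure.pi fun _ : Fin d => gaussianReal 0 1) = 0 := by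
    intro j
    have h := integral_id_gaussianReal (μ := 0) (v := 1)
    rw [← (hm j).map_eq, integral_map (hm j).measurable.aemeasurable (by fun_prop)] at h
    exact h
  ext j
  rw [eval_integral_piLp]
  · simp only [PiLp.add_apply, PiLp.smul_apply, smul_eq_mul]
    rw [integral_add (integrable_const _) ((hi j).const_mul s), integral_const_mul, h0]
    simp
  · intro k
    simp only [PiLp.add_apply, PiLp.smul_apply, smul_eq_mul]
    exact (integrable_const _).add ((hi k).const_mul s)

theorem lintegral_gaussianEstimate_sq {d : ℕ} (θ : EuclideanSpace ℝ (Fin d)) (s : ℝ) :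
    ∫⁻ ξ, ‖θ + s • (WithLp.toLp 2 ξ : EuclideanSpace ℝ (Fin d))‖ₑ ^ 2
      ∂(Measure.pi fun _ : Fin d => gaussianReal 0 1) =
      ENNReal.ofReal (‖θ‖ ^ 2 + s ^ 2 * d) := by
  have hj : ∀ j, ∫⁻ ξ, ENNReal.ofReal ((θ j + s * ξ j) ^ 2)
      ∂(Measure.pi fun _ : Fin d => gaussianReal 0 1) = ENNReal.ofReal (θ j ^ 2 + s ^ 2) := by
    intro j
    have hid : Integrable (fun x : ℝ => x) (gaussianReal 0 1) :=
      (memLp_id_gaussianReal 1).integrable (by norm_num)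
    have hsq : Integrable (fun x : ℝ => x ^ 2) (gaussianReal 0 1) :=
      (memLp_id_gaussianReal 2).integrable_sq
    have h2 : ∫ x, x ^ 2 ∂gaussianReal 0 1 = 1 := by
      have := variance_fun_id_gaussianReal (μ := 0) (v := 1)
      rw [variance_eq_integral (by fun_prop)] at this
      simpa using this
    have hm : MeasurePreserving (Function.eval j)
        (Measure.pi fun _ : Fin d => gaussianReal 0 1) (gaussianReal 0 1) :=
      measurePreserving_eval (fun _ : Fin d => gaussianReal 0 1) j
    have hmeas : Measurable fun x : ℝ => ENNReal.ofReal ((θ j + s * x) ^ 2) := by fun_prop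
    have e : (fun x => (θ j + s * x) ^ 2) =
        fun x => (θ j ^ 2 + 2 * θ j * s * x) + s ^ 2 * x ^ 2 := by ext x; ring
    have hi1 : Integrable (fun x => θ j ^ 2 + 2 * θ j * s * x) (gaussianReal 0 1) :=
      (integrable_const _).add (hid.const_mul _)
    have hi : Integrable (fun x => (θ j + s * x) ^ 2) (gaussianReal 0 1) := by
      rw [e]; exact hi1.add (hsq.const_mul _)
    have := hm.lintegral_comp hmeas
    simp only [Function.eval] at this
    rw [this, ← ofReal_integral_eq_lintegral_ofReal hi (ae_of_all _ fun x => sq_nonneg _), e,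
      integral_add hi1 (hsq.const_mul _), integral_add (integrable_const _) (hid.const_mul _),
      integral_const_mul, integral_const_mul, h2, integral_id_gaussianReal]
    simp
  have e : ∀ ξ : Fin d → ℝ, ‖θ + s • (WithLp.toLp 2 ξ : EuclideanSpace ℝ (Fin d))‖ₑ ^ 2 =
      ∑ j, ENNReal.ofReal ((θ j + s * ξ j) ^ 2) := by
    intro ξ
    rw [← ofReal_norm, ← ENNReal.ofReal_pow (norm_nonneg _), EuclideanSpace.norm_sq_eq,
      ENNReal.ofReal_sum_of_nonneg fun _ _ => sq_nonneg _]
    simp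
  simp_rw [e]
  rw [lintegral_finsetSum _ fun j _ => by fun_prop]
  simp_rw [hj]
  rw [← ENNReal.ofReal_sum_of_nonneg fun _ _ => by positivity, Finset.sum_add_distrib,
    EuclideanSpace.norm_sq_eq]
  simp [mul_comm]

/-- The linear function with gradient `θ`, together with the oracle that answers every query by
a Gaussian vector with mean `θ` and covariance `s² I`. -/
def gaussianOracle {d : ℕ} {X : Set (EuclideanSpace ℝ (Fin d))} (hX : Convex ℝ X) {B : ℝ}
    (θ : EuclideanSpace ℝ (Fin d)) (s : ℝ) (h : ‖θ‖ ^ 2 + s ^ 2 * d ≤ B ^ 2) :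
    FunctionOracle X B where
  f x := inner ℝ θ x
  convexOn := (innerₛₗ ℝ θ).convexOn hX
  Seed := Fin d → ℝ
  noise := Measure.pi fun _ => gaussianReal 0 1
  -- A linear function has the same gradient everywhere, so the query can be ignored.
  answer _ ξ := θ + s • WithLp.toLp 2 ξ
  measurable_answer := by
    have h : Measurable fun p : X × (Fin d → ℝ) =>
        (WithLp.toLp 2 p.2 : EuclideanSpace ℝ (Fin d)) :=
      (WithLp.measurable_toLp 2 _).comp measurable_snd
    exact (h.const_smul s).const_add θ
  unbiased x y _ := by
    rw [integral_gaussianEstimate, inner_sub_right]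
    linarith
  meanSquare x := by
    rw [lintegral_gaussianEstimate_sq]
    exact ENNReal.ofReal_le_ofReal h

/-! ### The cube and the gradients at its vertices. -/

/-- The cube with half-width `r`. -/
def cube (d : ℕ) (r : ℝ) : Set (EuclideanSpace ℝ (Fin d)) := {x | ∀ j, |x j| ≤ r}

theorem convex_cube (d : ℕ) (r : ℝ) : Convex ℝ (cube d r) := by
  intro x hx y hy a b ha hb hab j
  calc |(a • x + b • y) j| = |a * x j + b * y j| := by simp
    _ ≤ |a * x j| + |b * y j| := abs_add_le _ _
    _ = a * |x j| + b * |y j| := by rw [abs_mul, abs_mul, abs_of_nonneg ha, abs_of_nonneg hb]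
    _ ≤ a * r + b * r := by gcongr <;> [exact hx j; exact hy j]
    _ = r := by rw [← add_mul, hab, one_mul]

theorem isAdmissibleDomain_cube {d : ℕ} (hd : 1 ≤ d) {D : ℝ} (hD : 0 < D) :
    IsAdmissibleDomain D (cube d (D / (2 * √d))) where
  nonempty := ⟨0, fun j => by simp; positivity⟩
  convex := convex_cube _ _
  diam_le x hx y hy := by
    have hd' : (0 : ℝ) < d := by exact_mod_cast hd
    refine le_of_sq_le_sq ?_ hD.le
    rw [EuclideanSpace.norm_sq_eq]
    calc ∑ j, ‖(x - y) j‖ ^ 2 ≤ ∑ _j : Fin d, (D / √d) ^ 2 := by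
          refine Finset.sum_le_sum fun j _ => ?_
          gcongr
          rw [PiLp.sub_apply, Real.norm_eq_abs]
          calc |x j - y j| ≤ |x j| + |y j| := abs_sub _ _
            _ ≤ D / (2 * √d) + D / (2 * √d) := add_le_add (hx j) (hy j)
            _ = D / √d := by field_simp; norm_num
      _ = D ^ 2 := by
          rw [div_pow, Real.sq_sqrt hd'.le]
          simp
          field_simp

variable {d : ℕ} {X : Set (EuclideanSpace ℝ (Fin d))} {B P : ℝ}

/-- The vertex of the cube of half-width `δ` given by the bits `α`. -/
def vertex (δ : ℝ) (α : Fin d → Bool) : EuclideanSpace ℝ (Fin d) :=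
  WithLp.toLp 2 fun j => δ * sign (α j)

theorem norm_vertex_sq (δ : ℝ) (α : Fin d → Bool) : ‖vertex δ α‖ ^ 2 = δ ^ 2 * d := by
  rw [EuclideanSpace.norm_sq_eq]
  simp [vertex, mul_comm]

theorem inner_vertex (δ : ℝ) (α : Fin d → Bool) (x : EuclideanSpace ℝ (Fin d)) :
    inner ℝ (vertex δ α) x = δ * ∑ j, sign (α j) * x j := by
  rw [PiLp.inner_apply, Finset.mul_sum]
  refine Finset.sum_congr rfl fun j _ => ?_
  simp [vertex]
  ring

theorem vertex_sub_vertex_flipBit (δ : ℝ) (α : Fin d → Bool) (j : Fin d) :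
    vertex δ α - vertex δ (flipBit j α) = sign (α j) • EuclideanSpace.single j (2 * δ) := by
  ext k
  by_cases h : k = j
  · subst h
    simp [vertex, flipBit]
    ring
  · simp [vertex, flipBit, h]

theorem abs_sum_sign_mul_le (α : Fin d → Bool) {r : ℝ} {x : EuclideanSpace ℝ (Fin d)}
    (hx : x ∈ cube d r) : |∑ j, sign (α j) * x j| ≤ r * d := by
  calc |∑ j, sign (α j) * x j| ≤ ∑ j, |sign (α j) * x j| := Finset.abs_sum_le_sum_abs _ _
    _ ≤ ∑ _j : Fin d, r := Finset.sum_le_sum fun j _ => by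
        rw [abs_mul, abs_sign, one_mul]; exact hx j
    _ = r * d := by simp [mul_comm]

theorem iInf_inner_vertex_le {r δ : ℝ} (hr : 0 ≤ r) (hδ : 0 ≤ δ) (α : Fin d → Bool) :
    ⨅ x : cube d r, inner ℝ (vertex δ α) (x : EuclideanSpace ℝ (Fin d)) ≤ -(δ * (r * d)) := by
  -- Needed because a real infimum over a set unbounded below is 0 by convention.
  have hb : BddBelow (Set.range fun x : cube d r =>
      inner ℝ (vertex δ α) (x : EuclideanSpace ℝ (Fin d))) := by
    refine ⟨-(δ * (r * d)), ?_⟩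
    rintro _ ⟨x, rfl⟩
    simp only [inner_vertex]
    rw [← mul_neg]
    exact mul_le_mul_of_nonneg_left (neg_le_of_abs_le (abs_sum_sign_mul_le α x.2)) hδ
  -- The minimizer is the vertex opposite to the gradient.
  have hmem : vertex (-r) α ∈ cube d r := fun j => by
    simp [vertex, abs_mul, abs_of_nonneg hr]
  refine (ciInf_le hb ⟨_, hmem⟩).trans (le_of_eq ?_)
  simp only [inner_vertex]
  have : ∀ j, sign (α j) * vertex (-r) α j = -r := fun j => by
    simp only [vertex]
    linear_combination (-r) * sign_mul_self (α j)
  simp_rw [this]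
  rw [Finset.sum_const, Finset.card_univ, Fintype.card_fin, nsmul_eq_mul]
  ring

/-! ### Assouad's argument for analog protocols. -/

/-- The encoder of an analog protocol is linear in the estimate. -/
theorem Protocol.IsAnalog.exists_linearMap {π : Protocol X B P} (h : π.IsAnalog) :
    ∃ A : π.U → EuclideanSpace ℝ (Fin d) →ₗ[ℝ] (Fin π.ℓ → ℝ), ∀ g u, π.enc g u = A u g := by
  obtain ⟨-, M, hM⟩ := h
  exact ⟨fun u => (M u).mulVecLin ∘ₗ (WithLp.linearEquiv 2 ℝ (Fin d → ℝ)).toLinearMap,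
    fun g u => hM g u⟩

/-- Since the answers ignore the queries, the recursion through past outputs disappears and each
output depends only on the randomness of its own round. -/
theorem channelOutputs_gaussianOracle (π : Protocol X B P)
    {A : π.U → EuclideanSpace ℝ (Fin d) →ₗ[ℝ] (Fin π.ℓ → ℝ)} (hA : ∀ g u, π.enc g u = A u g)
    (hX : Convex ℝ X) (θ : EuclideanSpace ℝ (Fin d)) (s : ℝ)
    (h : ‖θ‖ ^ 2 + s ^ 2 * d ≤ B ^ 2) (u : Fin π.T → π.U)
    (ξ : Fin π.T → (gaussianOracle hX θ s h).Seed)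
    (z : Fin π.T → Fin π.ℓ → ℝ) (t : ℕ) (ht : t ≤ π.T) :
    π.channelOutputs (gaussianOracle hX θ s h) u ξ z t ht =
      fun k => linearOutputs (fun i => A (u i)) s θ (ξ, z) (Fin.castLE ht k) := by
  induction t with
  | zero => exact funext fun k => k.elim0
  | succ t ih =>
    funext k
    rw [Protocol.channelOutputs]
    refine Fin.lastCases ?_ (fun k => ?_) k
    · simp only [Fin.snoc_last, hA]
      rfl
    · simp only [Fin.snoc_castSucc, ih]
      rfl

theorem result_gaussianOracle (π : Protocol X B P)
    {A : π.U → EuclideanSpace ℝ (Fin d) →ₗ[ℝ] (Fin π.ℓ → ℝ)} (hA : ∀ g u, π.enc g u = A u g)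
    (hX : Convex ℝ X) (θ : EuclideanSpace ℝ (Fin d)) (s : ℝ)
    (h : ‖θ‖ ^ 2 + s ^ 2 * d ≤ B ^ 2) (u : Fin π.T → π.U)
    (ξ : Fin π.T → (gaussianOracle hX θ s h).Seed)
    (z : Fin π.T → Fin π.ℓ → ℝ) :
    π.result (gaussianOracle hX θ s h) u ξ z =
      π.output u (linearOutputs (fun i => A (u i)) s θ (ξ, z)) := by
  rw [Protocol.result, channelOutputs_gaussianOracle π hA]
  rfl

theorem measurable_coord_output (π : Protocol X B P)
    {A : π.U → EuclideanSpace ℝ (Fin d) →ₗ[ℝ] (Fin π.ℓ → ℝ)} (hA : ∀ g u, π.enc g u = A u g)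
    (θ : EuclideanSpace ℝ (Fin d)) (s : ℝ) (j : Fin d) :
    Measurable fun ω : (Fin π.T → π.U) × (Fin π.T → Fin d → ℝ) × (Fin π.T → Fin π.ℓ → ℝ) =>
      (π.output ω.1 (linearOutputs (fun i => A (ω.1 i)) s θ ω.2) :
        EuclideanSpace ℝ (Fin d)) j := by
  have hy : Measurable
      fun ω : (Fin π.T → π.U) × (Fin π.T → Fin d → ℝ) × (Fin π.T → Fin π.ℓ → ℝ) =>
        linearOutputs (fun i => A (ω.1 i)) s θ ω.2 := by
    refine measurable_pi_lambda _ fun t => ?_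
    -- `A` is not known to be measurable in `u`; the joint measurability of `enc` takes its place.
    simp only [linearOutputs, ← hA]
    refine Measurable.add ?_ ((measurable_pi_apply t).comp (measurable_snd.comp measurable_snd))
    refine π.measurable_enc.comp (Measurable.prodMk ?_
      ((measurable_pi_apply t).comp measurable_fst))
    have h : Measurable
        fun ω : (Fin π.T → π.U) × (Fin π.T → Fin d → ℝ) × (Fin π.T → Fin π.ℓ → ℝ) =>
          (WithLp.toLp 2 (ω.2.1 t) : EuclideanSpace ℝ (Fin d)) :=
      (WithLp.measurable_toLp 2 _).comp
        ((measurable_pi_apply t).comp (measurable_fst.comp measurable_snd))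
    exact (h.const_smul s).const_add θ
  have h := measurable_subtype_coe.comp (π.measurable_output.comp (measurable_fst.prodMk hy))
  exact (EuclideanSpace.proj (𝕜 := ℝ) j).continuous.measurable.comp h

/-- If, given the public randomness, moving the mean of the Gaussian oracle by `2δ` along a
coordinate axis can be absorbed by cheap shifts of the seeds and of the channel noise, then the
protocol has a large error for one of the linear functions with gradient in `{-δ, δ}^d`. -/
theorem exists_le_error {r δ s σ : ℝ} (hr : 0 ≤ r) (hδ : 0 ≤ δ) (hσ : 0 < σ)
    (hB : δ ^ 2 * d + s ^ 2 * d ≤ B ^ 2) (π : Protocol (cube d r) B P)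
    {A : π.U → EuclideanSpace ℝ (Fin d) →ₗ[ℝ] (Fin π.ℓ → ℝ)} (hA : ∀ g u, π.enc g u = A u g)
    {κ : (Fin π.T → π.U) → ℝ} (hκ : Integrable κ π.law) (hκ' : ∫ u, κ u ∂π.law ≤ d / 8)
    (h : ∀ u : Fin π.T → π.U, ∃ (p : Fin d → Fin π.T → EuclideanSpace ℝ (Fin d))
      (q : Fin d → Fin π.T → Fin π.ℓ → ℝ),
      (∀ j t, A (u t) (EuclideanSpace.single j (2 * δ)) = A (u t) (s • p j t) + q j t) ∧
      ∑ j, (∑ t, ‖p j t‖ ^ 2 + ∑ t, ∑ i, q j t i ^ 2 / σ ^ 2) ≤ κ u) :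
    ∃ O : FunctionOracle (cube d r) B, 3 / 4 * (δ * (r * d)) ≤ π.error O σ := by
  have hB' : ∀ α : Fin d → Bool, ‖vertex δ α‖ ^ 2 + s ^ 2 * d ≤ B ^ 2 := fun α => by
    rwa [norm_vertex_sq]
  let O (α : Fin d → Bool) : FunctionOracle (cube d r) B :=
    gaussianOracle (convex_cube d r) (vertex δ α) s (hB' α)
  let v : NNReal := ⟨σ ^ 2, sq_nonneg σ⟩
  have hv : v ≠ 0 := by
    intro hv
    have : σ ^ 2 = 0 := congrArg NNReal.toReal hv
    exact hσ.ne' (pow_eq_zero_iff two_ne_zero |>.1 this)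
  let ν := noiseLaw d π.ℓ π.T v
  let F (α : Fin d → Bool) (j : Fin d)
      (ω : (Fin π.T → π.U) × (Fin π.T → Fin d → ℝ) × (Fin π.T → Fin π.ℓ → ℝ)) : ℝ :=
    (π.output ω.1 (linearOutputs (fun i => A (ω.1 i)) s (vertex δ α) ω.2) :
      EuclideanSpace ℝ (Fin d)) j
  have hF : ∀ α j, Integrable (F α j) (π.law.prod ν) := fun α j =>
    Integrable.of_bound (measurable_coord_output π hA _ s j).aestronglyMeasurable r
      (ae_of_all _ fun ω => Subtype.prop (π.output ω.1 _) j)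
  let J (u : Fin π.T → π.U) (j : Fin d) (α : Fin d → Bool) : ℝ := ∫ ω, F α j (u, ω) ∂ν
  have hJ : ∀ j α, Integrable (fun u => J u j α) π.law := fun j α => (hF α j).integral_prod_left
  have hsum : Integrable (fun u => ∑ α, ∑ j, sign (α j) * J u j α) π.law :=
    integrable_finsetSum _ fun α _ => integrable_finsetSum _ fun j _ => (hJ j α).const_mul _
  have herr : ∀ α, δ * (r * d) + δ * ∑ j, sign (α j) * ∫ u, J u j α ∂π.law ≤
      π.error (O α) σ := by
    intro α
    have e1 : ∫ ω, (O α).f (π.result (O α) ω.1 ω.2.1 ω.2.2) ∂(π.jointLaw (O α) σ) =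
        ∫ ω, δ * ∑ j, sign (α j) * F α j ω ∂(π.law.prod ν) := by
      refine integral_congr_ae (ae_of_all _ fun ω => ?_)
      have := result_gaussianOracle π hA (convex_cube d r) (vertex δ α) s (hB' α) ω.1 ω.2.1 ω.2.2
      simp only [O]
      rw [this]
      exact inner_vertex δ α _
    have e2 : ∫ ω, δ * ∑ j, sign (α j) * F α j ω ∂(π.law.prod ν) =
        δ * ∑ j, sign (α j) * ∫ u, J u j α ∂π.law := by
      rw [integral_const_mul, integral_finsetSum _ fun j _ => (hF α j).const_mul _]
      congr 1
      refine Finset.sum_congr rfl fun j _ => ?_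
      rw [integral_const_mul, integral_prod _ (hF α j)]
    have e3 : ⨅ x : cube d r, (O α).f x ≤ -(δ * (r * d)) := iInf_inner_vertex_le hr hδ α
    rw [Protocol.error, e1, e2]
    linarith
  -- The shifts depend on the matrices, so the sign average is bounded for fixed `u`. Linearity in
  -- `κ u` means that only the mean of `κ` matters afterwards.
  have hu : ∀ u, -(2 ^ d / 2 * (r * (d / 4 + 2 * κ u))) ≤ ∑ α, ∑ j, sign (α j) * J u j α := by
    intro u
    obtain ⟨p, q, hpq, hK⟩ := h u
    have hb := sum_sign_mul_ge (J u)
      (fun j => r * (1 / 4 + 2 * (∑ t, ‖p j t‖ ^ 2 + ∑ t, ∑ i, q j t i ^ 2 / σ ^ 2))) (by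
        intro j α
        have hm : Measurable fun y => (π.output u y : EuclideanSpace ℝ (Fin d)) j :=
          (EuclideanSpace.proj (𝕜 := ℝ) j).continuous.measurable.comp
            (measurable_subtype_coe.comp (π.measurable_output.comp measurable_prodMk_left))
        have hs := abs_integral_linearOutputs_sub_le (fun i => A (u i)) s hv
          (θ := vertex δ (flipBit j α)) (θ' := vertex δ α) (p := fun t => sign (α j) • p j t)
          (q := fun t => sign (α j) • q j t) (by
            intro t
            rw [vertex_sub_vertex_flipBit, map_smul, hpq, smul_add, smul_comm s (sign (α j)),
              map_smul (A (u t)) (sign (α j))])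
          hm (fun y => Subtype.prop (π.output u y) j)
        have e1 : ∀ t, ‖sign (α j) • p j t‖ ^ 2 = ‖p j t‖ ^ 2 := fun t => by
          rw [norm_smul, Real.norm_eq_abs, abs_sign, one_mul]
        have e2 : ∀ t i, (sign (α j) • q j t) i ^ 2 / v = q j t i ^ 2 / σ ^ 2 := fun t i => by
          rw [Pi.smul_apply, smul_eq_mul, mul_pow, sq (sign _), sign_mul_self, one_mul]
          rfl
        simp only [e1, e2] at hs
        exact hs)
    refine le_trans (neg_le_neg ?_) hb
    rw [← Finset.mul_sum, Finset.sum_add_distrib, ← Finset.mul_sum]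
    have : ∑ _j : Fin d, (1 / 4 : ℝ) = d / 4 := by simp; ring
    rw [this]
    gcongr
  have hint : -(2 ^ d / 2 * (r * (d / 4 + 2 * ∫ u, κ u ∂π.law))) ≤
      ∑ α, ∑ j, sign (α j) * ∫ u, J u j α ∂π.law := by
    have e1 : ∑ α, ∑ j, sign (α j) * ∫ u, J u j α ∂π.law =
        ∫ u, ∑ α, ∑ j, sign (α j) * J u j α ∂π.law := by
      rw [integral_finsetSum _ fun α _ => integrable_finsetSum _ fun j _ => (hJ j α).const_mul _]
      refine Finset.sum_congr rfl fun α _ => ?_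
      rw [integral_finsetSum _ fun j _ => (hJ j α).const_mul _]
      exact Finset.sum_congr rfl fun j _ => (integral_const_mul _ _).symm
    have hi : Integrable (fun u => (d / 4 : ℝ) + 2 * κ u) π.law :=
      (integrable_const _).add (hκ.const_mul 2)
    have e2 : ∫ u, -(2 ^ d / 2 * (r * (d / 4 + 2 * κ u))) ∂π.law =
        -(2 ^ d / 2 * (r * (d / 4 + 2 * ∫ u, κ u ∂π.law))) := by
      rw [integral_neg, integral_const_mul, integral_const_mul,
        integral_add (integrable_const _) (hκ.const_mul 2), integral_const_mul]
      simp
    rw [e1, ← e2]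
    exact integral_mono ((hi.const_mul r).const_mul _).neg hsum hu
  have hcard : ∑ _α : Fin d → Bool, 3 / 4 * (δ * (r * d)) = 2 ^ d * (3 / 4 * (δ * (r * d))) := by
    simp
  have hcard' : ∑ _α : Fin d → Bool, δ * (r * d) = 2 ^ d * (δ * (r * d)) := by simp
  have htotal : ∑ _α : Fin d → Bool, 3 / 4 * (δ * (r * d)) ≤ ∑ α, π.error (O α) σ := by
    refine le_trans ?_ (Finset.sum_le_sum fun α _ => herr α)
    rw [Finset.sum_add_distrib, hcard, hcard', ← Finset.mul_sum]
    -- The budget `d/8` gives `(d/4 + 2 * (d/8)) / 2 = d/4`: a quarter of `δ r d` is lost.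
    have h1 : (2 : ℝ) ^ d / 2 * (r * (d / 4 + 2 * ∫ u, κ u ∂π.law)) ≤
        2 ^ d / 2 * (r * (d / 4 + 2 * (d / 8))) := by gcongr
    have h2 := mul_le_mul_of_nonneg_left ((neg_le_neg h1).trans hint) hδ
    nlinarith [h2]
  obtain ⟨α, -, hα⟩ := Finset.exists_le_of_sum_le Finset.univ_nonempty htotal
  exact ⟨O α, hα⟩

/-! ### The two regimes of the signal-to-noise ratio. -/

/-- The power constraint for the deterministic estimate `g`. -/
theorem Protocol.integral_enc_sq_le (π : Protocol X B P) (hP : 0 ≤ P) (t : Fin π.T)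
    {g : EuclideanSpace ℝ (Fin d)} (hg : ‖g‖ ^ 2 ≤ B ^ 2) :
    Integrable (fun u : Fin π.T → π.U => ∑ i, π.enc g (u t) i ^ 2) π.law ∧
      ∫ u, ∑ i, π.enc g (u t) i ^ 2 ∂π.law ≤ π.ℓ * P := by
  have hm : Measurable fun u : Fin π.T → π.U => ∑ i, π.enc g (u t) i ^ 2 := by
    have h : Measurable fun u : Fin π.T → π.U => π.enc g (u t) :=
      π.measurable_enc.comp (measurable_prodMk_left.comp (measurable_pi_apply t))
    exact Finset.measurable_sum _ fun i _ => ((measurable_pi_apply i).comp h).pow_const 2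
  have hn : ∀ u : Fin π.T → π.U, 0 ≤ ∑ i, π.enc g (u t) i ^ 2 :=
    fun u => Finset.sum_nonneg fun i _ => sq_nonneg _
  have hpow := π.power t (Measure.dirac g) inferInstance (by
    rw [lintegral_dirac, ← ofReal_norm, ← ENNReal.ofReal_pow (norm_nonneg _)]
    exact ENNReal.ofReal_le_ofReal hg)
  simp only [lintegral_dirac] at hpow
  constructor
  · refine ⟨hm.aestronglyMeasurable, ?_⟩
    rw [hasFiniteIntegral_iff_ofReal (ae_of_all _ hn)]
    exact hpow.trans_lt ENNReal.ofReal_lt_top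
  · rw [integral_eq_lintegral_of_nonneg_ae (ae_of_all _ hn) hm.aestronglyMeasurable]
    exact ENNReal.toReal_le_of_le_ofReal (by positivity) hpow

/-- At low signal-to-noise ratio, the shifts are absorbed by the channel noise. -/
theorem exists_le_error_of_power {r δ s σ : ℝ} (hr : 0 ≤ r) (hδ : 0 ≤ δ) (hσ : 0 < σ)
    (hB0 : 0 < B) (hP : 0 ≤ P) (hB : δ ^ 2 * d + s ^ 2 * d ≤ B ^ 2)
    (π : Protocol (cube d r) B P) (hπ : π.IsAnalog) {N : ℕ} (hN : π.ℓ * π.T ≤ N)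
    (hδN : 32 * (δ ^ 2 * N * P) ≤ B ^ 2 * σ ^ 2) :
    ∃ O : FunctionOracle (cube d r) B, 3 / 4 * (δ * (r * d)) ≤ π.error O σ := by
  obtain ⟨A, hA⟩ := hπ.exists_linearMap
  have hN' : (π.ℓ : ℝ) * π.T ≤ N := by exact_mod_cast hN
  -- These vectors have the largest norm that the power constraint covers. By linearity the image of
  -- `2δ e_j` is `2δ/B` times theirs, which explains `c`.
  let e (j : Fin d) : EuclideanSpace ℝ (Fin d) := EuclideanSpace.single j B
  have he : ∀ j, ‖e j‖ ^ 2 ≤ B ^ 2 := fun j => by simp [e]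
  let c : ℝ := (2 * δ / B) ^ 2 / σ ^ 2
  have hc : 0 ≤ c := by positivity
  let κ (u : Fin π.T → π.U) : ℝ := c * ∑ j, ∑ t, ∑ i, π.enc (e j) (u t) i ^ 2
  have hi : ∀ j, Integrable (fun u : Fin π.T → π.U => ∑ t, ∑ i, π.enc (e j) (u t) i ^ 2) π.law :=
    fun j => integrable_finsetSum _ fun t _ => (π.integral_enc_sq_le hP t (he j)).1
  refine exists_le_error hr hδ hσ hB π hA (κ := κ)
    ((integrable_finsetSum _ fun j _ => hi j).const_mul c) ?_ fun u => ?_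
  · simp only [κ]
    rw [integral_const_mul, integral_finsetSum _ fun j _ => hi j]
    have h1 : ∑ j, ∫ u, ∑ t, ∑ i, π.enc (e j) (u t) i ^ 2 ∂π.law ≤
        ∑ _j : Fin d, ∑ _t : Fin π.T, (π.ℓ : ℝ) * P := by
      refine Finset.sum_le_sum fun j _ => ?_
      rw [integral_finsetSum _ fun t _ => (π.integral_enc_sq_le hP t (he j)).1]
      exact Finset.sum_le_sum fun t _ => (π.integral_enc_sq_le hP t (he j)).2
    calc _ ≤ c * ∑ _j : Fin d, ∑ _t : Fin π.T, (π.ℓ : ℝ) * P :=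
          mul_le_mul_of_nonneg_left h1 hc
      _ = c * P * d * (π.ℓ * π.T) := by simp; ring
      _ ≤ c * P * d * N := by gcongr
      _ = (32 * (δ ^ 2 * N * P)) / (B ^ 2 * σ ^ 2) * (d / 8) := by
          simp only [c]; field_simp; ring
      _ ≤ 1 * (d / 8) := by
          gcongr
          exact div_le_one_of_le₀ hδN (by positivity)
      _ = d / 8 := one_mul _
  · refine ⟨fun _ _ => 0, fun j t => A (u t) (EuclideanSpace.single j (2 * δ)),
      fun j t => by simp, le_of_eq ?_⟩
    have e1 : ∀ j t i, A (u t) (EuclideanSpace.single j (2 * δ)) i ^ 2 / σ ^ 2 =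
        c * π.enc (e j) (u t) i ^ 2 := by
      intro j t i
      have : (EuclideanSpace.single j (2 * δ) : EuclideanSpace ℝ (Fin d)) =
          (2 * δ / B) • e j := by
        ext k
        by_cases hk : k = j <;> simp [e, hk]
        field_simp
      rw [this, hA, map_smul, Pi.smul_apply, smul_eq_mul]
      simp only [c]
      ring
    simp only [e1, κ, Finset.mul_sum]
    simp

/-- At high signal-to-noise ratio, the shifts are absorbed by the randomness of the oracle, of
which the channel shows only `ℓ` dimensions per query. -/
theorem exists_le_error_of_dimension {r δ s σ : ℝ} (hr : 0 ≤ r) (hδ : 0 ≤ δ) (hσ : 0 < σ)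
    (hs : 0 < s) (hB : δ ^ 2 * d + s ^ 2 * d ≤ B ^ 2)
    (π : Protocol (cube d r) B P) (hπ : π.IsAnalog) {N : ℕ} (hN : π.ℓ * π.T ≤ N)
    (hδN : 32 * (δ ^ 2 * N) ≤ s ^ 2 * d) :
    ∃ O : FunctionOracle (cube d r) B, 3 / 4 * (δ * (r * d)) ≤ π.error O σ := by
  obtain ⟨A, hA⟩ := hπ.exists_linearMap
  have hN' : (π.ℓ : ℝ) * π.T ≤ N := by exact_mod_cast hN
  refine exists_le_error hr hδ hσ hB π hA (κ := fun _ => d / 8) (integrable_const _) (by simp)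
    fun u => ?_
  -- The seeds are moved only in directions that `A (u t)` sees, so a round costs `(2δ/s)² ℓ` over
  -- all coordinates, where moving along the `e_j` themselves would cost `(2δ/s)² d`.
  choose p hp hp' using fun t => exists_preimages_sum_sq_le (A (u t))
  refine ⟨fun j t => (2 * δ / s) • p t j, fun _ _ _ => 0, fun j t => ?_, ?_⟩
  · have : (EuclideanSpace.single j (2 * δ) : EuclideanSpace ℝ (Fin d)) =
        (2 * δ) • EuclideanSpace.single j 1 := by
      ext k
      by_cases hk : k = j <;> simp [hk]
    rw [this, smul_smul, mul_div_cancel₀ _ hs.ne', map_smul, map_smul, hp]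
    exact (add_zero _).symm
  · have e1 : ∀ j t, ‖(2 * δ / s) • p t j‖ ^ 2 = (2 * δ / s) ^ 2 * ‖p t j‖ ^ 2 := fun j t => by
      rw [norm_smul, mul_pow, Real.norm_eq_abs, sq_abs]
    simp only [e1]
    calc _ = (2 * δ / s) ^ 2 * ∑ t, ∑ j, ‖p t j‖ ^ 2 := by
          simp only [Finset.mul_sum, ne_eq, OfNat.ofNat_ne_zero, not_false_eq_true, zero_pow,
            zero_div, Finset.sum_const_zero, add_zero]
          exact Finset.sum_comm
      _ ≤ (2 * δ / s) ^ 2 * ∑ _t : Fin π.T, (π.ℓ : ℝ) := by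
          gcongr with t
          exact hp' t
      _ = (2 * δ / s) ^ 2 * (π.ℓ * π.T) := by simp [mul_comm]
      _ ≤ (2 * δ / s) ^ 2 * N := by gcongr
      _ = (32 * (δ ^ 2 * N)) / s ^ 2 / 8 := by field_simp; ring
      _ ≤ (s ^ 2 * d) / s ^ 2 / 8 := by gcongr
      _ = d / 8 := by field_simp

/-! ### Choice of the parameters. -/

theorem le_analogMinimaxError {N : ℕ} {D B P σ : ℝ} (hd : 1 ≤ d) (hD : 0 < D) (hB : 0 < B)
    (hP : 0 < P) (hσ : 0 < σ) (hN : (d : ℝ) * (1 + 1 / snr P σ) ≤ N) :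
    ((1 / 64 * D * B / √(N : ℝ) * √((d : ℝ) + d / snr P σ) : ℝ) : EReal) ≤
      analogMinimaxError d N D B P σ := by
  have hd0 : (0 : ℝ) < d := by exact_mod_cast hd
  have hsnr : 0 < snr P σ := by unfold snr; positivity
  -- `1/m` agrees with `1 + 1/SNR` up to a factor of 2.
  set m := min 1 (snr P σ) with hm
  have hm0 : 0 < m := lt_min one_pos hsnr
  have hm1 : m ≤ 1 := min_le_left _ _
  have hm2 : m ≤ snr P σ := min_le_right _ _
  have hinv : 1 + 1 / snr P σ ≤ 2 / m := by
    have h1 : 1 ≤ 1 / m := (one_le_div hm0).2 hm1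
    have h2 : 1 / snr P σ ≤ 1 / m := one_div_le_one_div_of_le hm0 hm2
    calc _ ≤ 1 / m + 1 / m := add_le_add h1 h2
      _ = 2 / m := by ring
  have hinv' : 1 / m ≤ 1 + 1 / snr P σ := by
    have h0 : 0 < 1 / snr P σ := by positivity
    rcases min_choice 1 (snr P σ) with h | h <;> rw [hm, h] <;> linarith [div_one (1 : ℝ)]
  -- The lower bound on `N` enters here; it keeps `‖θ‖² = δ² d` below `B²/64`, which leaves room for
  -- the variance.
  have hNm : (d : ℝ) ≤ N * m := by
    have := (mul_le_mul_of_nonneg_left hinv' hd0.le).trans hN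
    rwa [mul_one_div, div_le_iff₀ hm0] at this
  have hNm0 : 0 < N * m := hd0.trans_le hNm
  have hN0 : (0 : ℝ) < N := pos_of_mul_pos_left hNm0 hm0.le
  -- The noise gets `s² d = B²/2`. With `δ² N m = B²/64`, the condition of the high-SNR case holds
  -- with equality and that of the low-SNR case with a factor of 2 to spare.
  let δ := B / (8 * √(N * m))
  let s := B / √(2 * d)
  let r := D / (2 * √d)
  have hδ0 : 0 ≤ δ := by positivity
  have hs0 : 0 < s := by positivity
  have hr0 : 0 ≤ r := by positivity
  have hδ2 : δ ^ 2 * (N * m) = B ^ 2 / 64 := by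
    simp only [δ]
    rw [div_pow, mul_pow, Real.sq_sqrt hNm0.le]
    field_simp
    norm_num
  have hs2 : s ^ 2 * d = B ^ 2 / 2 := by
    simp only [s]
    rw [div_pow, Real.sq_sqrt (by positivity)]
    field_simp
  have hδd : δ ^ 2 * d ≤ B ^ 2 / 64 := by
    rw [← hδ2]; gcongr
  have hBB : δ ^ 2 * d + s ^ 2 * d ≤ B ^ 2 := by
    rw [hs2]; linarith [sq_nonneg B]
  have hval : 1 / 64 * D * B / √(N : ℝ) * √((d : ℝ) + d / snr P σ) ≤
      3 / 4 * (δ * (r * d)) := by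
    have h1 : √((d : ℝ) + d / snr P σ) ≤ 2 * (√d / √m) := by
      rw [Real.sqrt_le_left (by positivity), mul_pow, div_pow, Real.sq_sqrt hd0.le,
        Real.sq_sqrt hm0.le]
      have h2 := mul_le_mul_of_nonneg_left hinv hd0.le
      have h3 : (d : ℝ) * (2 / m) ≤ 2 ^ 2 * (d / m) := by
        have : 0 < (d : ℝ) / m := by positivity
        calc (d : ℝ) * (2 / m) = 2 * (d / m) := by ring
          _ ≤ 2 ^ 2 * (d / m) := by linarith
      calc (d : ℝ) + d / snr P σ = d * (1 + 1 / snr P σ) := by ring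
        _ ≤ _ := h2.trans h3
    have hsd : √(d : ℝ) * √d = d := Real.mul_self_sqrt hd0.le
    calc _ ≤ 1 / 64 * D * B / √(N : ℝ) * (2 * (√d / √m)) := by gcongr
      _ ≤ 3 / 64 * D * B / √(N : ℝ) * (√d / √m) := by
          have : 0 < D * B / √(N : ℝ) * (√d / √m) := by positivity
          calc _ = 2 / 64 * (D * B / √(N : ℝ) * (√d / √m)) := by ring
            _ ≤ 3 / 64 * (D * B / √(N : ℝ) * (√d / √m)) := by gcongr; norm_num
            _ = _ := by ring
      _ = 3 / 4 * (δ * (r * d)) := by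
          simp only [δ, r]
          rw [Real.sqrt_mul hN0.le]
          conv_rhs => rw [← hsd]
          field_simp
          norm_num
  unfold analogMinimaxError
  refine le_iSup₂_of_le (cube d r) (isAdmissibleDomain_cube hd hD) ?_
  refine le_iInf₂ fun π hπ => ?_
  have hO : ∃ O : FunctionOracle (cube d r) B, 3 / 4 * (δ * (r * d)) ≤ π.error O σ := by
    rcases le_total 1 (snr P σ) with h | h
    · refine exists_le_error_of_dimension hr0 hδ0 hσ hs0 hBB π hπ.1 hπ.2 ?_
      have : m = 1 := min_eq_left h
      rw [this, mul_one] at hδ2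
      rw [hδ2, hs2]
      linarith
    · refine exists_le_error_of_power hr0 hδ0 hσ hB hP.le hBB π hπ.1 hπ.2 ?_
      have : m = P / σ ^ 2 := min_eq_right h
      rw [this] at hδ2
      have e : δ ^ 2 * N * P = δ ^ 2 * (N * (P / σ ^ 2)) * σ ^ 2 := by field_simp
      rw [e, hδ2]
      have : 0 < B ^ 2 * σ ^ 2 := by positivity
      linarith
  obtain ⟨O, hO⟩ := hO
  exact le_iSup_of_le O (EReal.coe_le_coe_iff.2 (hval.trans hO))

end OverTheAir

end

theorem theorem3 :
    ∃ c : ℝ, 0 < c ∧ c < 1 ∧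
      ∀ (d N : ℕ) (D B P σ : ℝ), 1 ≤ d → 0 < D → 0 < B → 0 < P → 0 < σ →
        (d : ℝ) * (1 + 1 / OverTheAir.snr P σ) ≤ N →
        ((c * D * B / √(N : ℝ) * √((d : ℝ) + d / OverTheAir.snr P σ) : ℝ) : EReal) ≤
          OverTheAir.analogMinimaxError d N D B P σ :=
  ⟨1 / 64, by norm_num, by norm_num, fun _ _ _ _ _ _ hd hD hB hP hσ hN =>
    OverTheAir.le_analogMinimaxError hd hD hB hP hσ hN⟩
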